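/- Let $h:(0,\infty)\to\mathbb{R}$ be differentiable, increasing, concave and bounded below, and consider the Rukhin-type loss $$W(\theta,\hat\theta,\hat L)=h'(\hat L)\,L(\theta,\hat\theta)-h'(\hat L)\,\hat L+h(\hat L)$$ for estimating simultaneously $\theta$ by $\hat\theta(X)$ and the incurred first-stage loss $L=L(\theta,\hat\theta(X))\ge 0$ by $\hat L(X)\in(0,\infty)$. (The choice $h(t)=2t^{1/2}$ gives Rukhin's loss $\hat L^{-1/2}L+\hat L^{1/2}$.) A pair of measurable functions $(\hat\theta,\hat L)$ is called minimax if $$\sup_\theta \mathbb{E}_\theta W(\theta,\hat\theta(X),\hat L(X))\le\sup_\theta \mathbb{E}_\theta W(\theta,\hat\theta'(X),\hat L'(X))$$ for all pairs $(\hat\theta',\hat L')$ of measurable functions with $\hat L'>0$ (the risks take values in $(-\infty,+\infty]$). An estimator $\hat\theta$ dominates $\hat\theta_0(X)=X$ under the first-stage loss $L$ if $\mathbb{E}_\theta L(\theta,\hat\theta(X))\le \mathbb{E}_\theta L(\theta,X)$ for all $\theta$, with strict inequality for some $\theta$. Then the following hold. (a) Let $X\sim N_d(\theta,\sigma^2 I_d)$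 with $\theta\in\mathbb{R}^d$ unknown, $\sigma>0$ known and $d\ge 3$, and let $L(\theta,\hat\theta)=\|\hat\theta-\theta\|^2/\sigma^2$. If $\hat\theta(X)$ dominates $X$ under $L$, then $(\hat\theta,\hat L_0)$ with the constant $\hat L_0\equiv d$ is minimax. (b) Let $X\sim N_d(\theta,\sigma^2 I_d)$ with $\theta\in\mathbb{R}^d$ unknown, $\sigma>0$ known and $d\ge 4$, and let $L(\theta,\hat\theta)=\beta(\|\hat\theta-\theta\|^2/\sigma^2)$, where $\beta:[0,\infty)\to[0,\infty)$ is continuous, strictly increasing and concave. If $\hat\theta(X)$ dominates $X$ under $L$, then $(\hat\theta,\hat L_0)$ with the constant $\hat L_0\equiv\mathbb{E}\,\beta(Z)$, $Z\sim\chi^2_d$, is minimax. (c) Let $X=(X_1,\dots,X_d)$ with independent $X_i\sim\mathrm{Poisson}(\theta_i)$, $\theta\in(0,\infty)^d$ unknown and $d\ge 2$, and let $L(\theta,\hat\theta)=\sum_{i=1}^d(\hat\theta_i-\theta_i)^2/\theta_i$ for $\hat\theta\in\mathbb{R}^d$. If $\hat\theta(X)$ dominates $X$ under $L$, then $(\hat\theta,\hat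 L_0)$ with the constant $\hat L_0\equiv d$ is minimax. -/

import Mathlib

open MeasureTheory ProbabilityTheory

/-- The extended expectation `E[W⁺] - E[W⁻]` of a real random variable `W` under `μ`. It is an
unambiguous element of `(-∞, +∞]` whenever `W` is bounded below and `μ` is a probability measure,
and it is the usual expectation when `W` is integrable. -/
noncomputable def extExpectation {𝓧 : Type*} [MeasurableSpace 𝓧] (μ : Measure 𝓧) (W : 𝓧 → ℝ) :
    EReal :=
  ((∫⁻ x, ENNReal.ofReal (W x) ∂μ : ENNReal) : EReal) -
    ((∫⁻ x, ENNReal.ofReal (-(W x)) ∂μ : ENNReal) : EReal)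

/-- Frequentist risk at `θ` of the estimator `est` of `θ` in the model `P`, under the first-stage
loss `L θ a`. -/
noncomputable def firstStageRisk {Θ 𝓧 A : Type*} [MeasurableSpace 𝓧] (P : Θ → Measure 𝓧)
    (L : Θ → A → ℝ) (est : 𝓧 → A) (θ : Θ) : EReal :=
  extExpectation (P θ) fun x => L θ (est x)

/-- `est₁` dominates `est₀` under the loss `L`: its risk is nowhere larger, and it is strictly
smaller at some parameter value. -/
def Dominates {Θ 𝓧 A : Type*} [MeasurableSpace 𝓧] (P : Θ → Measure 𝓧) (L : Θ → A → ℝ)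
    (est₁ est₀ : 𝓧 → A) : Prop :=
  (∀ θ, firstStageRisk P L est₁ θ ≤ firstStageRisk P L est₀ θ) ∧
    ∃ θ, firstStageRisk P L est₁ θ < firstStageRisk P L est₀ θ

/-- The Rukhin-type loss `h'(l) L - h'(l) l + h(l)` incurred when the first-stage loss `L` is
estimated by `l > 0`. -/
noncomputable def rukhinLoss (h : ℝ → ℝ) (L l : ℝ) : ℝ :=
  deriv h l * L - deriv h l * l + h l

/-- Frequentist risk at `θ` of the pair `(est, lossEst)` under the Rukhin-type loss. -/
noncomputable def rukhinRisk {Θ 𝓧 A : Type*} [MeasurableSpace 𝓧] (P : Θ → Measure 𝓧)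
    (L : Θ → A → ℝ) (h : ℝ → ℝ) (est : 𝓧 → A) (lossEst : 𝓧 → ℝ) (θ : Θ) : EReal :=
  extExpectation (P θ) fun x => rukhinLoss h (L θ (est x)) (lossEst x)

/-- `(est, lossEst)` is an estimator of `(θ, L)`: both components are measurable, and the loss
estimate takes values in `(0, ∞)`. -/
def IsPairEstimator {𝓧 A : Type*} [MeasurableSpace 𝓧] [MeasurableSpace A]
    (est : 𝓧 → A) (lossEst : 𝓧 → ℝ) : Prop :=
  Measurable est ∧ Measurable lossEst ∧ ∀ x, 0 < lossEst x

/-- `(est, lossEst)` is minimax for estimating `(θ, L)` simultaneously under the Rukhin-type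
loss: it is an estimator, and no estimator has smaller supremum risk. -/
def IsRukhinMinimax {Θ 𝓧 A : Type*} [MeasurableSpace 𝓧] [MeasurableSpace A] (P : Θ → Measure 𝓧)
    (L : Θ → A → ℝ) (h : ℝ → ℝ) (est : 𝓧 → A) (lossEst : 𝓧 → ℝ) : Prop :=
  IsPairEstimator est lossEst ∧
    ∀ (est' : 𝓧 → A) (lossEst' : 𝓧 → ℝ), IsPairEstimator est' lossEst' →
      ⨆ θ, rukhinRisk P L h est lossEst θ ≤ ⨆ θ, rukhinRisk P L h est' lossEst' θ

/-- The normal model `X ∼ N_d(θ, σ² I_d)`, `θ ∈ ℝ^d`. -/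
noncomputable def normalModel (d : ℕ) (σ : ℝ) (θ : EuclideanSpace ℝ (Fin d)) :
    Measure (EuclideanSpace ℝ (Fin d)) :=
  multivariateGaussian θ ((σ ^ 2) • (1 : Matrix (Fin d) (Fin d) ℝ))

/-- The loss `‖a - θ‖² / σ²`. -/
noncomputable def scaledSqLoss (d : ℕ) (σ : ℝ) (θ a : EuclideanSpace ℝ (Fin d)) : ℝ :=
  ‖a - θ‖ ^ 2 / σ ^ 2

/-- The (central) `χ²_d` distribution: the law of `‖Y‖²` for a standard Gaussian vector `Y` in
`ℝ^d`. -/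
noncomputable def chiSquare (d : ℕ) : Measure ℝ :=
  (stdGaussian (EuclideanSpace ℝ (Fin d))).map fun y => ‖y‖ ^ 2

/-- The multivariate Poisson model: `X₁, …, X_d` independent with `X_i ∼ Poisson(θ_i)`,
`θ ∈ (0, ∞)^d`. -/
noncomputable def poissonModel (d : ℕ) (θ : Fin d → {t : ℝ // 0 < t}) : Measure (Fin d → ℕ) :=
  Measure.pi fun i => poissonMeasure (Real.toNNReal (θ i : ℝ))

/-- The loss `∑ i, (a_i - θ_i)² / θ_i`. -/
noncomputable def poissonLoss (d : ℕ) (θ : Fin d → {t : ℝ // 0 < t}) (a : Fin d → ℝ) : ℝ :=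
  ∑ i, (a i - (θ i : ℝ)) ^ 2 / (θ i : ℝ)

/-- For `h(t) = 2 t^{1/2}` the Rukhin-type loss is `l^{-1/2} L + l^{1/2}`. -/
theorem rukhinLoss_two_sqrt (L l : ℝ) (hl : 0 < l) :
    rukhinLoss (fun t => 2 * Real.sqrt t) L l = (Real.sqrt l)⁻¹ * L + Real.sqrt l := by
  have hs : Real.sqrt l ≠ 0 := (Real.sqrt_pos.2 hl).ne'
  have hd : deriv (fun t => 2 * Real.sqrt t) l = (Real.sqrt l)⁻¹ := by
    rw [((Real.hasDerivAt_sqrt hl.ne').const_mul 2).deriv]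
    field_simp
  have hm : (Real.sqrt l)⁻¹ * l = Real.sqrt l := by
    have := Real.mul_self_sqrt hl.le
    field_simp
    nlinarith
  unfold rukhinLoss
  rw [hd, hm]
  ring

/-- `h(t) = 2 t^{1/2}` is increasing, concave, differentiable and bounded below on `(0, ∞)`. -/
theorem two_sqrt_admissible :
    DifferentiableOn ℝ (fun t => 2 * Real.sqrt t) (Set.Ioi 0) ∧
      MonotoneOn (fun t => 2 * Real.sqrt t) (Set.Ioi 0) ∧
      ConcaveOn ℝ (Set.Ioi 0) (fun t => 2 * Real.sqrt t) ∧
      BddBelow ((fun t => 2 * Real.sqrt t) '' Set.Ioi 0) := by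
  refine ⟨?_, ?_, ?_, ?_⟩
  · intro t ht
    exact ((Real.hasDerivAt_sqrt (Set.mem_Ioi.1 ht).ne').const_mul
      2).differentiableAt.differentiableWithinAt
  · intro a _ b _ hab
    exact mul_le_mul_of_nonneg_left (Real.sqrt_le_sqrt hab) (by norm_num)
  · have h1 := Real.strictConcaveOn_sqrt.concaveOn.subset Set.Ioi_subset_Ici_self
      (convex_Ioi (0 : ℝ))
    exact h1.smul (by norm_num : (0 : ℝ) ≤ 2)
  · refine ⟨0, ?_⟩
    rintro _ ⟨t, _, rfl⟩
    positivity

/-! In all three models the minimax value is `h l`, where `l` is the constant risk of `X`. Upper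
bound: for the constant loss estimate `l` the Rukhin loss is affine in `L` with slope `deriv h l ≥
0` and value `h l` at `L = l`, so first-stage risk at most `l` gives Rukhin risk at most `h l`
(`rukhinRisk_const_le`). Lower bound: suppose a prior has all posterior first-stage risks at least
`v`. The posterior Rukhin risk at `x` is then at least the tangent to `h` at the loss estimate,
evaluated at `v`; by concavity this is at least `h v`, so the supremum risk is too
(`le_iSup_rukhinRisk_of_bayes`). Conjugate priors reach `v = r * l` for every `r < 1`, and
continuity of `h` lets `r` tend to 1 (`isRukhinMinimax_const`). For the normal model the prior is
centred normal, and Anderson's inequality places the best action at the posterior mean. For the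
Poisson model it is a product of gamma laws, whose posterior risk is an explicit quadratic in each
coordinate of the action. -/

/-! ### Product densities and the standard Gaussian. -/

theorem lintegral_pi_prod_eq_prod_lintegral {n : ℕ} {E : Fin n → Type*}
    [∀ i, MeasurableSpace (E i)] {μ : (i : Fin n) → Measure (E i)} [∀ i, SigmaFinite (μ i)]
    {f : (i : Fin n) → E i → ENNReal} (hf : ∀ i, Measurable (f i)) :
    ∫⁻ x, ∏ i, f i (x i) ∂(Measure.pi μ) = ∏ i, ∫⁻ x, f i x ∂(μ i) := by
  induction n with
  | zero => simp
  | succ n ih =>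
    have hm : Measurable fun y : (i : Fin n) → E i.succ => ∏ i, f i.succ (y i) :=
      Finset.measurable_fun_prod _ fun i _ => (hf i.succ).comp (measurable_pi_apply i)
    rw [← ((measurePreserving_piFinSuccAbove μ 0).symm).lintegral_comp_emb
      (MeasurableEquiv.measurableEmbedding _), Fin.prod_univ_succ, ← ih fun i => hf i.succ,
      ← lintegral_prod_mul (hf 0).aemeasurable hm.aemeasurable]
    refine lintegral_congr fun x => ?_
    rw [Fin.prod_univ_succ]
    rfl

theorem pi_withDensity {n : ℕ} {E : Fin n → Type*}
    [∀ i, MeasurableSpace (E i)] {μ : (i : Fin n) → Measure (E i)} [∀ i, SigmaFinite (μ i)]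
    {f : (i : Fin n) → E i → ENNReal} (hf : ∀ i, Measurable (f i))
    (hfin : ∀ i, SigmaFinite ((μ i).withDensity (f i))) :
    Measure.pi (fun i => (μ i).withDensity (f i)) =
      (Measure.pi μ).withDensity fun x => ∏ i, f i (x i) := by
  refine Measure.pi_eq fun s hs => ?_
  rw [withDensity_apply _ (MeasurableSet.univ_pi hs), ← lintegral_indicator (MeasurableSet.univ_pi hs)]
  simp_rw [withDensity_apply _ (hs _), ← lintegral_indicator (hs _)]
  rw [← lintegral_pi_prod_eq_prod_lintegral fun i => (hf i).indicator (hs i)]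
  refine lintegral_congr fun x => ?_
  by_cases hx : x ∈ Set.univ.pi s
  · rw [Set.indicator_of_mem hx]
    exact Finset.prod_congr rfl fun i _ => (Set.indicator_of_mem (hx i trivial) _).symm
  · rw [Set.indicator_of_notMem hx]
    simp only [Set.mem_univ_pi, not_forall] at hx
    obtain ⟨i, hi⟩ := hx
    exact (Finset.prod_eq_zero (Finset.mem_univ i) (Set.indicator_of_notMem hi _)).symm

theorem stdGaussian_eq_withDensity (d : ℕ) :
    stdGaussian (EuclideanSpace ℝ (Fin d)) = volume.withDensity fun y =>
      ENNReal.ofReal ((√(2 * Real.pi))⁻¹ ^ d * Real.exp (-(‖y‖ ^ 2 / 2))) := by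
  have h1 : (Measure.pi fun _ : Fin d => gaussianReal 0 1) =
      (volume : Measure (Fin d → ℝ)).withDensity fun x => ENNReal.ofReal
        ((√(2 * Real.pi))⁻¹ ^ d * Real.exp (-(‖WithLp.toLp 2 x‖ ^ 2 / 2))) := by
    have hg : gaussianReal 0 1 = volume.withDensity (gaussianPDF 0 1) :=
      gaussianReal_of_var_ne_zero 0 one_ne_zero
    have : ∀ _ : Fin d, SigmaFinite ((volume : Measure ℝ).withDensity (gaussianPDF 0 1)) := by
      intro _; rw [← hg]; infer_instance
    rw [hg, pi_withDensity (μ := fun _ : Fin d => (volume : Measure ℝ))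
      (f := fun _ => gaussianPDF 0 1) (fun _ => measurable_gaussianPDF 0 1) this, ← volume_pi]
    congr 1
    ext x
    simp only [gaussianPDF]
    rw [← ENNReal.ofReal_prod_of_nonneg fun i _ => gaussianPDFReal_nonneg _ _ _]
    simp only [gaussianPDFReal, Finset.prod_mul_distrib, ← Real.exp_sum, EuclideanSpace.norm_sq_eq]
    simp [Finset.sum_div, neg_div]
  rw [← map_pi_eq_stdGaussian, h1]
  have hv := PiLp.volume_preserving_toLp (Fin d)
  refine Measure.ext_of_lintegral _ fun f hf => ?_
  rw [lintegral_map hf (by fun_prop), lintegral_withDensity_eq_lintegral_mul _ (by fun_prop)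
    (by fun_prop), lintegral_withDensity_eq_lintegral_mul _ (by fun_prop) hf,
    ← hv.lintegral_comp (by fun_prop)]
  rfl

/-- A Gaussian form of Anderson's inequality: centring at the mean minimizes the expectation of a
monotone function of the distance. -/
theorem lintegral_norm_le_lintegral_norm_sub_stdGaussian (d : ℕ) {f : ℝ → ENNReal}
    (hf : Monotone f) (w : EuclideanSpace ℝ (Fin d)) :
    ∫⁻ y, f ‖y‖ ∂(stdGaussian (EuclideanSpace ℝ (Fin d))) ≤
      ∫⁻ y, f ‖y - w‖ ∂(stdGaussian (EuclideanSpace ℝ (Fin d))) := by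
  have hfm : Measurable f := hf.measurable
  set p : ℝ → ENNReal := fun u =>
    ENNReal.ofReal ((√(2 * Real.pi))⁻¹ ^ d * Real.exp (-(u ^ 2 / 2))) with hp
  have hpm : Measurable p := by fun_prop
  have hanti : ∀ u v, 0 ≤ u → u ≤ v → p v ≤ p u := by
    intro u v hu huv
    simp only [hp]
    gcongr
  -- Rearrangement inequality: `p` decreases on `[0, ∞)` while `f` increases. The excess `e` of `p
  -- u` over `p v` stands in for a subtraction in `ENNReal`.
  have hrearr : ∀ u v : ℝ, 0 ≤ u → 0 ≤ v → p u * f u + p v * f v ≤ p u * f v + p v * f u := by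
    have key : ∀ u v : ℝ, 0 ≤ u → u ≤ v → p u * f u + p v * f v ≤ p u * f v + p v * f u := by
      intro u v hu huv
      obtain ⟨e, he⟩ := exists_add_of_le (hanti u v hu huv)
      calc p u * f u + p v * f v = p v * f u + e * f u + p v * f v := by rw [he, add_mul]
        _ ≤ p v * f u + e * f v + p v * f v := by gcongr; exact hf huv
        _ = p u * f v + p v * f u := by rw [he]; ring
    intro u v hu hv
    rcases le_total u v with h | h
    · exact key u v hu h
    · have := key v u hv h
      rwa [add_comm, add_comm (p v * f u)] at this
  have hden : stdGaussian (EuclideanSpace ℝ (Fin d)) = volume.withDensity fun y => p ‖y‖ :=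
    stdGaussian_eq_withDensity d
  rw [hden, lintegral_withDensity_eq_lintegral_mul _ (by fun_prop) (by fun_prop),
    lintegral_withDensity_eq_lintegral_mul _ (by fun_prop) (by fun_prop)]
  simp only [Pi.mul_apply]
  have hs1 : ∫⁻ y : EuclideanSpace ℝ (Fin d), p ‖y - w‖ * f ‖y - w‖ = ∫⁻ y, p ‖y‖ * f ‖y‖ :=
    lintegral_sub_right_eq_self (fun y : EuclideanSpace ℝ (Fin d) => p ‖y‖ * f ‖y‖) w
  -- The reflection `y ↦ w - y` swaps `‖y‖` and `‖y - w‖`, so the two mixed terms of the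
  -- rearrangement have equal integrals, as the two diagonal ones do by translation.
  have hs2 : ∫⁻ y : EuclideanSpace ℝ (Fin d), p ‖y - w‖ * f ‖y‖ = ∫⁻ y, p ‖y‖ * f ‖y - w‖ := by
    rw [← lintegral_sub_left_eq_self (fun y : EuclideanSpace ℝ (Fin d) => p ‖y‖ * f ‖y - w‖) w]
    refine lintegral_congr fun y => ?_
    rw [norm_sub_rev w y, sub_sub_cancel_left, norm_neg]
  have hsum : (2 : ENNReal) * ∫⁻ y : EuclideanSpace ℝ (Fin d), p ‖y‖ * f ‖y‖ ≤
      2 * ∫⁻ y : EuclideanSpace ℝ (Fin d), p ‖y‖ * f ‖y - w‖ := by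
    rw [two_mul, two_mul]
    nth_rewrite 2 [← hs1]
    nth_rewrite 2 [← hs2]
    rw [← lintegral_add_left (by fun_prop), ← lintegral_add_left (by fun_prop)]
    exact lintegral_mono fun y => hrearr _ _ (norm_nonneg _) (norm_nonneg _)
  exact (ENNReal.mul_le_mul_iff_right (by norm_num) (by norm_num)).1 hsum

theorem lintegral_norm_sq_stdGaussian (d : ℕ) :
    ∫⁻ y, ENNReal.ofReal (‖y‖ ^ 2) ∂(stdGaussian (EuclideanSpace ℝ (Fin d))) = d := by
  rw [← map_pi_eq_stdGaussian, lintegral_map (by fun_prop) (by fun_prop)]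
  have h1 : ∫⁻ t, ENNReal.ofReal (t ^ 2) ∂(gaussianReal 0 1) = 1 := by
    rw [← ofReal_integral_eq_lintegral_ofReal]
    · have := variance_of_integral_eq_zero (X := id) (μ := gaussianReal 0 1) (by fun_prop)
        (by simp [integral_id_gaussianReal])
      rw [variance_id_gaussianReal] at this
      simp only [id] at this
      rw [← this]; simp
    · exact (IsGaussian.memLp_two_id (μ := gaussianReal 0 1)).integrable_sq
    · exact ae_of_all _ fun t => sq_nonneg t
  simp_rw [EuclideanSpace.norm_sq_eq]
  simp only [Real.norm_eq_abs, sq_abs]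
  simp_rw [ENNReal.ofReal_sum_of_nonneg fun i _ => sq_nonneg _]
  rw [lintegral_finsetSum _ fun i _ => by fun_prop]
  have h2 : ∀ i : Fin d, ∫⁻ x, ENNReal.ofReal (x i ^ 2)
      ∂(Measure.pi fun _ : Fin d => gaussianReal 0 1) = 1 := fun i => by
    rw [← h1]
    exact (measurePreserving_eval (fun _ : Fin d => gaussianReal 0 1) i).lintegral_comp
      (f := fun t => ENNReal.ofReal (t ^ 2)) (by fun_prop)
  simp [h2]

open scoped MatrixOrder in
theorem normalModel_eq_map (d : ℕ) {σ : ℝ} (hσ : 0 < σ) (θ : EuclideanSpace ℝ (Fin d)) :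
    normalModel d σ θ =
      (stdGaussian (EuclideanSpace ℝ (Fin d))).map fun y => θ + σ • y := by
  have hsq : CFC.sqrt ((σ ^ 2) • (1 : Matrix (Fin d) (Fin d) ℝ)) =
      σ • (1 : Matrix (Fin d) (Fin d) ℝ) := by
    refine CFC.sqrt_unique ?_ ?_
    · simp [sq, smul_smul]
    · exact (Matrix.PosSemidef.one.smul hσ.le).nonneg
  rw [normalModel, multivariateGaussian, hsq]
  simp

/-- Bayes' formula for a centred normal prior with standard deviation `σ tan φ`. -/
theorem lintegral_normal_bayes (d : ℕ) (σ φ : ℝ) (hc : Real.cos φ ≠ 0)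
    {F : EuclideanSpace ℝ (Fin d) → EuclideanSpace ℝ (Fin d) → ENNReal}
    (hF : Measurable fun p : EuclideanSpace ℝ (Fin d) × EuclideanSpace ℝ (Fin d) => F p.1 p.2) :
    let γ := stdGaussian (EuclideanSpace ℝ (Fin d))
    ∫⁻ u, ∫⁻ y, F ((σ * Real.tan φ) • u) ((σ * Real.tan φ) • u + σ • y) ∂γ ∂γ =
      ∫⁻ x, ∫⁻ z, F ((Real.sin φ ^ 2) • ((σ / Real.cos φ) • x) + (σ * Real.sin φ) • z)
        ((σ / Real.cos φ) • x) ∂γ ∂γ := by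
  intro γ
  -- Rotation invariance of `γ ⊗ γ` permits `u = sin φ x + cos φ z`, `y = cos φ x - sin φ z`. Then
  -- `z` cancels from the observation `σ tan φ u + σ y`, leaving `(σ / cos φ) x`.
  have hrot := IsGaussian.map_rotation_eq_self (μ := γ)
    (integral_id_stdGaussian (E := EuclideanSpace ℝ (Fin d))) (-φ)
  have hG : Measurable fun p : EuclideanSpace ℝ (Fin d) × EuclideanSpace ℝ (Fin d) =>
      F ((σ * Real.tan φ) • p.2) ((σ * Real.tan φ) • p.2 + σ • p.1) :=
    hF.comp (f := fun p : EuclideanSpace ℝ (Fin d) × EuclideanSpace ℝ (Fin d) =>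
      ((σ * Real.tan φ) • p.2, (σ * Real.tan φ) • p.2 + σ • p.1)) (by fun_prop)
  have hH : Measurable fun p : EuclideanSpace ℝ (Fin d) × EuclideanSpace ℝ (Fin d) =>
      F ((Real.sin φ ^ 2) • ((σ / Real.cos φ) • p.1) + (σ * Real.sin φ) • p.2)
        ((σ / Real.cos φ) • p.1) :=
    hF.comp (f := fun p : EuclideanSpace ℝ (Fin d) × EuclideanSpace ℝ (Fin d) =>
      ((Real.sin φ ^ 2) • ((σ / Real.cos φ) • p.1) + (σ * Real.sin φ) • p.2,
        (σ / Real.cos φ) • p.1)) (by fun_prop)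
  rw [← lintegral_prod_symm _ hG.aemeasurable, ← lintegral_prod _ hH.aemeasurable, ← hrot,
    lintegral_map hG (by fun_prop), hrot]
  refine lintegral_congr fun p => ?_
  have h1 := Real.sin_sq_add_cos_sq φ
  simp only [ContinuousLinearMap.rotation_apply, Real.cos_neg, Real.sin_neg, neg_neg,
    Real.tan_eq_sin_div_cos]
  congr 1
  · rw [smul_add, smul_smul, smul_smul, smul_smul]
    congr 2 <;> field_simp
  · have h2 : σ * (Real.sin φ / Real.cos φ) * Real.sin φ + σ * Real.cos φ = σ / Real.cos φ := by
      field_simp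
      linear_combination σ * h1
    have h3 : σ * (Real.sin φ / Real.cos φ) * Real.cos φ + σ * -Real.sin φ = 0 := by
      field_simp
      ring
    rw [smul_add, smul_add, smul_smul, smul_smul, smul_smul, smul_smul, add_add_add_comm,
      ← add_smul, ← add_smul, h2, h3, zero_smul, add_zero]

/-! ### Expectations bounded below, and tangent lines of concave functions. -/

/-- The lower bound makes the negative part integrable, so no `∞ - ∞` arises. Risks become integrals
of nonnegative functions, which can be interchanged without integrability conditions. -/
theorem extExpectation_eq_lintegral_add {𝓧 : Type*} [MeasurableSpace 𝓧] (μ : Measure 𝓧)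
    [IsProbabilityMeasure μ] {W : 𝓧 → ℝ} (hW : Measurable W) {m : ℝ} (hm : ∀ x, m ≤ W x) :
    extExpectation μ W = ((∫⁻ x, ENNReal.ofReal (W x - m) ∂μ : ENNReal) : EReal) + (m : EReal) := by
  have hpt : ∀ x, ENNReal.ofReal (W x - m) + ENNReal.ofReal (-(W x)) + ENNReal.ofReal m =
      ENNReal.ofReal (W x) + ENNReal.ofReal (-m) := by
    intro x
    have h1 := hm x
    rcases le_total 0 (W x) with h | h <;> rcases le_total 0 m with h' | h'
    · rw [ENNReal.ofReal_of_nonpos (by linarith : -W x ≤ 0),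
        ENNReal.ofReal_of_nonpos (by linarith : -m ≤ 0), add_zero, add_zero,
        ← ENNReal.ofReal_add (by linarith) h']
      ring_nf
    · rw [ENNReal.ofReal_of_nonpos (by linarith : -W x ≤ 0), ENNReal.ofReal_of_nonpos h',
        add_zero, add_zero, ← ENNReal.ofReal_add h (by linarith)]
      ring_nf
    · have : W x = 0 := by linarith
      have : m = 0 := by linarith
      simp [*]
    · rw [ENNReal.ofReal_of_nonpos h, ENNReal.ofReal_of_nonpos h', zero_add, add_zero,
        ← ENNReal.ofReal_add (by linarith) (by linarith)]
      ring_nf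
  have hint := lintegral_congr (μ := μ) hpt
  rw [lintegral_add_right _ measurable_const, lintegral_add_right _ measurable_const,
    lintegral_add_right _ (by fun_prop), lintegral_const, lintegral_const, measure_univ, mul_one,
    mul_one] at hint
  have hN : ∫⁻ x, ENNReal.ofReal (-(W x)) ∂μ ≠ ⊤ := by
    refine ne_top_of_le_ne_top (b := ENNReal.ofReal (-m)) ENNReal.ofReal_ne_top ?_
    calc ∫⁻ x, ENNReal.ofReal (-(W x)) ∂μ ≤ ∫⁻ _, ENNReal.ofReal (-m) ∂μ :=
          lintegral_mono fun x => ENNReal.ofReal_le_ofReal (by linarith [hm x])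
      _ = ENNReal.ofReal (-m) := by simp
  unfold extExpectation
  generalize ∫⁻ x, ENNReal.ofReal (W x - m) ∂μ = A at *
  generalize ∫⁻ x, ENNReal.ofReal (-(W x)) ∂μ = N at *
  generalize ∫⁻ x, ENNReal.ofReal (W x) ∂μ = R at *
  lift N to NNReal using hN
  by_cases hA : A = ⊤
  · subst hA
    have hR : R = ⊤ := by
      by_contra hR
      rw [top_add, top_add] at hint
      exact (ENNReal.add_ne_top.2 ⟨hR, ENNReal.ofReal_ne_top⟩) hint.symm
    subst hR
    rw [EReal.coe_ennreal_top, EReal.top_add_coe]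
    exact EReal.top_sub_coe _
  · have hR : R ≠ ⊤ := by
      rintro rfl
      rw [top_add] at hint
      exact (ENNReal.add_ne_top.2 ⟨ENNReal.add_ne_top.2 ⟨hA, ENNReal.coe_ne_top⟩,
        ENNReal.ofReal_ne_top⟩) hint
    lift A to NNReal using hA
    lift R to NNReal using hR
    have h3 := congrArg ENNReal.toReal hint
    rw [ENNReal.toReal_add (by finiteness) (by finiteness),
      ENNReal.toReal_add (by finiteness) (by finiteness),
      ENNReal.toReal_add (by finiteness) (by finiteness), ENNReal.toReal_ofReal',
      ENNReal.toReal_ofReal'] at h3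
    simp only [ENNReal.coe_toReal] at h3
    have h4 : max m 0 - max (-m) 0 = m := by
      exact max_zero_sub_max_neg_zero_eq_self m
    change (((R : ℝ)) : EReal) - ((N : ℝ) : EReal) = ((A : ℝ) : EReal) + (m : EReal)
    rw [← EReal.coe_sub, ← EReal.coe_add]
    congr 1
    linarith

theorem ConcaveOn.le_add_deriv_mul_sub {h : ℝ → ℝ} (h_diff : DifferentiableOn ℝ h (Set.Ioi 0))
    (h_conc : ConcaveOn ℝ (Set.Ioi 0) h) {t l : ℝ} (ht : 0 < t) (hl : 0 < l) :
    h t ≤ h l + deriv h l * (t - l) := by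
  have hd : DifferentiableAt ℝ h l := h_diff.differentiableAt (Ioi_mem_nhds hl)
  rcases lt_trichotomy t l with h1 | rfl | h1
  · have := h_conc.deriv_le_slope ht hl h1 hd
    rw [slope_def_field, le_div_iff₀ (by linarith)] at this
    linarith
  · simp
  · have := h_conc.slope_le_deriv hl ht h1 hd
    rw [slope_def_field, div_le_iff₀ (by linarith)] at this
    linarith

theorem MonotoneOn.deriv_nonneg_of_pos {h : ℝ → ℝ} (h_mono : MonotoneOn h (Set.Ioi 0)) {l : ℝ}
    (hl : 0 < l) : 0 ≤ deriv h l := by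
  rw [← derivWithin_of_isOpen isOpen_Ioi (Set.mem_Ioi.2 hl)]
  exact h_mono.derivWithin_nonneg

/-- The right side is the tangent at `l` evaluated at 0; the tangent lies above `h ≥ m` on `(0, ∞)`,
and `t → 0⁺` gives the bound. Hence the Rukhin loss is at least `m` whenever `L ≥ 0`. -/
theorem le_sub_deriv_mul_of_concaveOn {h : ℝ → ℝ} (h_diff : DifferentiableOn ℝ h (Set.Ioi 0))
    (h_conc : ConcaveOn ℝ (Set.Ioi 0) h) {m : ℝ} (hm : ∀ t, 0 < t → m ≤ h t) {l : ℝ}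
    (hl : 0 < l) : m ≤ h l - deriv h l * l := by
  have ht : Filter.Tendsto (fun t => h l + deriv h l * (t - l)) (nhdsWithin 0 (Set.Ioi 0))
      (nhds (h l + deriv h l * (0 - l))) := by
    refine Filter.Tendsto.mono_left ?_ nhdsWithin_le_nhds
    exact Continuous.tendsto (by fun_prop) 0
  have := ge_of_tendsto ht (Filter.eventually_of_mem self_mem_nhdsWithin fun t ht =>
    (hm t ht).trans (h_conc.le_add_deriv_mul_sub h_diff ht hl))
  linarith

/-! ### Bayes lower bound and the minimax criterion. -/

section Minimax

variable {Θ 𝓧 A : Type*} [MeasurableSpace Θ] [MeasurableSpace 𝓧] [MeasurableSpace A]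

theorem measurable_rukhinLoss {L : Θ → A → ℝ} {h : ℝ → ℝ} (h_diff : DifferentiableOn ℝ h (Set.Ioi 0))
    (hL : Measurable (Function.uncurry L)) {est : 𝓧 → A} {l : 𝓧 → ℝ} (hp : IsPairEstimator est l) :
    Measurable fun p : Θ × 𝓧 => rukhinLoss h (L p.1 (est p.2)) (l p.2) := by
  obtain ⟨he, hl, hpos⟩ := hp
  have h1 : Measurable fun x => h (l x) :=
    (continuousOn_iff_continuous_domRestrict.1 h_diff.continuousOn).measurable.comp
      (hl.subtype_mk (p := fun t => t ∈ Set.Ioi (0 : ℝ)) (h := hpos))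
  have h2 : Measurable fun x => deriv h (l x) := (measurable_deriv h).comp hl
  have h3 : Measurable fun p : Θ × 𝓧 => L p.1 (est p.2) :=
    hL.comp (measurable_fst.prodMk (he.comp measurable_snd))
  unfold rukhinLoss
  exact (((h2.comp measurable_snd).mul h3).sub
    ((h2.mul hl).comp measurable_snd)).add (h1.comp measurable_snd)

theorem rukhinRisk_eq_lintegral_add {P : Θ → Measure 𝓧} [∀ θ, IsProbabilityMeasure (P θ)]
    {L : Θ → A → ℝ} {h : ℝ → ℝ} (h_diff : DifferentiableOn ℝ h (Set.Ioi 0))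
    (h_mono : MonotoneOn h (Set.Ioi 0)) (h_conc : ConcaveOn ℝ (Set.Ioi 0) h)
    (hL : Measurable (Function.uncurry L)) (hL0 : ∀ θ a, 0 ≤ L θ a) {m : ℝ}
    (hm : ∀ t, 0 < t → m ≤ h t) {est : 𝓧 → A} {l : 𝓧 → ℝ} (hp : IsPairEstimator est l) (θ : Θ) :
    rukhinRisk P L h est l θ =
      ((∫⁻ x, ENNReal.ofReal (rukhinLoss h (L θ (est x)) (l x) - m) ∂(P θ) : ENNReal) : EReal)
        + (m : EReal) := by
  refine extExpectation_eq_lintegral_add (P θ)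
    ((measurable_rukhinLoss h_diff hL hp).comp measurable_prodMk_left) fun x => ?_
  have h1 := le_sub_deriv_mul_of_concaveOn h_diff h_conc hm (hp.2.2 x)
  have h2 := mul_nonneg (h_mono.deriv_nonneg_of_pos (hp.2.2 x)) (hL0 θ (est x))
  simp only [Function.comp_apply, rukhinLoss]
  linarith

/-- A prior all of whose posterior first-stage risks are at least `v` bounds the supremum
Rukhin risk of every estimator from below by `h v`. -/
theorem le_iSup_rukhinRisk_of_bayes {P : Θ → Measure 𝓧} [∀ θ, IsProbabilityMeasure (P θ)]
    {L : Θ → A → ℝ} {h : ℝ → ℝ} (h_diff : DifferentiableOn ℝ h (Set.Ioi 0))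
    (h_mono : MonotoneOn h (Set.Ioi 0)) (h_conc : ConcaveOn ℝ (Set.Ioi 0) h)
    (h_bdd : BddBelow (h '' Set.Ioi 0))
    (hL : Measurable (Function.uncurry L)) (hL0 : ∀ θ a, 0 ≤ L θ a)
    (π : Measure Θ) [IsProbabilityMeasure π] (κ : Measure 𝓧) (Q : 𝓧 → Measure Θ)
    [∀ x, IsProbabilityMeasure (Q x)]
    (hbayes : ∀ F : Θ → 𝓧 → ENNReal, Measurable (Function.uncurry F) →
      ∫⁻ θ, ∫⁻ x, F θ x ∂(P θ) ∂π = ∫⁻ x, ∫⁻ θ, F θ x ∂(Q x) ∂κ)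
    {v : ℝ} (hv : 0 < v) (hpost : ∀ x a, ENNReal.ofReal v ≤ ∫⁻ θ, ENNReal.ofReal (L θ a) ∂(Q x))
    {est : 𝓧 → A} {l : 𝓧 → ℝ} (hp : IsPairEstimator est l) :
    (h v : EReal) ≤ ⨆ θ, rukhinRisk P L h est l θ := by
  obtain ⟨m, hm⟩ := h_bdd
  replace hm : ∀ t, 0 < t → m ≤ h t := fun t ht => hm ⟨t, ht, rfl⟩
  by_contra hlt
  obtain ⟨c, hc1, hc2⟩ := EReal.lt_iff_exists_real_btwn.1 (not_le.1 hlt)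
  have hc2 : c < h v := EReal.coe_lt_coe_iff.1 hc2
  have hrisk : ∀ θ, ((∫⁻ x, ENNReal.ofReal (rukhinLoss h (L θ (est x)) (l x) - m) ∂(P θ) :
      ENNReal) : EReal) + (m : EReal) ≤ c := fun θ => by
    rw [← rukhinRisk_eq_lintegral_add h_diff h_mono h_conc hL hL0 hm hp θ]
    exact (le_iSup _ θ).trans hc1.le
  -- Needed so that `ENNReal.ofReal (c - m)` does not truncate.
  have hmc : m ≤ c := by
    have : Nonempty Θ := π.nonempty_of_neZero
    have h1 := hrisk (Classical.arbitrary Θ)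
    have h2 : ((0 : EReal) + (m : EReal)) ≤ c :=
      (add_le_add_left (EReal.coe_ennreal_nonneg _) _).trans h1
    rw [zero_add] at h2
    exact EReal.coe_le_coe_iff.1 h2
  have hA : ∀ θ, ∫⁻ x, ENNReal.ofReal (rukhinLoss h (L θ (est x)) (l x) - m) ∂(P θ) ≤
      ENNReal.ofReal (c - m) := fun θ => by
    have h1 := (EReal.le_sub_iff_add_le (Or.inl (EReal.coe_ne_bot m))
      (Or.inl (EReal.coe_ne_top m))).2 (hrisk θ)
    rw [← EReal.coe_ennreal_le_coe_ennreal_iff, EReal.coe_ennreal_ofReal,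
      max_eq_left (sub_nonneg.2 hmc), EReal.coe_sub]
    exact h1
  -- Bayes' formula with `F = 1` shows that the marginal `κ` has mass one.
  have hκ : κ Set.univ = 1 := by
    have := hbayes (fun _ _ => 1) measurable_const
    simpa using this.symm
  have hup : ∫⁻ θ, ∫⁻ x, ENNReal.ofReal (rukhinLoss h (L θ (est x)) (l x) - m) ∂(P θ) ∂π ≤
      ENNReal.ofReal (c - m) := by
    refine (lintegral_mono hA).trans ?_
    simp
  rw [hbayes (fun θ x => ENNReal.ofReal (rukhinLoss h (L θ (est x)) (l x) - m))
    ((measurable_rukhinLoss h_diff hL hp).sub_const m).ennreal_ofReal] at hup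
  -- The posterior Rukhin risk at `x` is at least the tangent at `l x` evaluated at `v`, because the
  -- slope is nonnegative; concavity puts this above `h v`.
  have hlow : ∀ x, ENNReal.ofReal (h v - m) ≤
      ∫⁻ θ, ENNReal.ofReal (rukhinLoss h (L θ (est x)) (l x) - m) ∂(Q x) := fun x => by
    have hd := h_mono.deriv_nonneg_of_pos (hp.2.2 x)
    have hi := sub_nonneg.2 (le_sub_deriv_mul_of_concaveOn h_diff h_conc hm (hp.2.2 x))
    calc ENNReal.ofReal (h v - m)
        ≤ ENNReal.ofReal (deriv h (l x) * v + (h (l x) - deriv h (l x) * l x - m)) := by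
          refine ENNReal.ofReal_le_ofReal ?_
          linarith [h_conc.le_add_deriv_mul_sub h_diff hv (hp.2.2 x)]
      _ = ENNReal.ofReal (deriv h (l x)) * ENNReal.ofReal v +
          ENNReal.ofReal (h (l x) - deriv h (l x) * l x - m) := by
          rw [ENNReal.ofReal_add (by positivity) hi, ENNReal.ofReal_mul hd]
      _ ≤ ENNReal.ofReal (deriv h (l x)) * ∫⁻ θ, ENNReal.ofReal (L θ (est x)) ∂(Q x) +
          ENNReal.ofReal (h (l x) - deriv h (l x) * l x - m) := by
          gcongr
          exact hpost x (est x)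
      _ = ∫⁻ θ, (ENNReal.ofReal (deriv h (l x)) * ENNReal.ofReal (L θ (est x)) +
          ENNReal.ofReal (h (l x) - deriv h (l x) * l x - m)) ∂(Q x) := by
          rw [lintegral_add_right _ measurable_const, lintegral_const_mul' _ _ ENNReal.ofReal_ne_top,
            lintegral_const, measure_univ, mul_one]
      _ = _ := by
          refine lintegral_congr fun θ => ?_
          rw [← ENNReal.ofReal_mul hd, ← ENNReal.ofReal_add (mul_nonneg hd (hL0 _ _)) hi, rukhinLoss]
          ring_nf
  have h1 : ENNReal.ofReal (h v - m) ≤ ENNReal.ofReal (c - m) := by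
    refine le_trans ?_ ((lintegral_mono hlow).trans hup)
    simp [hκ]
  rw [ENNReal.ofReal_le_ofReal_iff (sub_nonneg.2 hmc)] at h1
  linarith

theorem rukhinRisk_const_le {P : Θ → Measure 𝓧} [∀ θ, IsProbabilityMeasure (P θ)]
    {L : Θ → A → ℝ} {h : ℝ → ℝ} (h_diff : DifferentiableOn ℝ h (Set.Ioi 0))
    (h_mono : MonotoneOn h (Set.Ioi 0)) (h_conc : ConcaveOn ℝ (Set.Ioi 0) h)
    (h_bdd : BddBelow (h '' Set.Ioi 0))
    (hL : Measurable (Function.uncurry L)) (hL0 : ∀ θ a, 0 ≤ L θ a) {est : 𝓧 → A}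
    (he : Measurable est) {l : ℝ} (hl : 0 < l) {θ : Θ}
    (hrisk : ∫⁻ x, ENNReal.ofReal (L θ (est x)) ∂(P θ) ≤ ENNReal.ofReal l) :
    rukhinRisk P L h est (fun _ => l) θ ≤ h l := by
  obtain ⟨m, hm⟩ := h_bdd
  replace hm : ∀ t, 0 < t → m ≤ h t := fun t ht => hm ⟨t, ht, rfl⟩
  rw [rukhinRisk_eq_lintegral_add h_diff h_mono h_conc hL hL0 hm ⟨he, measurable_const, fun _ => hl⟩]
  have hd := h_mono.deriv_nonneg_of_pos hl
  have hi := sub_nonneg.2 (le_sub_deriv_mul_of_concaveOn h_diff h_conc hm hl)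
  have key : ∫⁻ x, ENNReal.ofReal (rukhinLoss h (L θ (est x)) l - m) ∂(P θ) ≤
      ENNReal.ofReal (h l - m) :=
    calc ∫⁻ x, ENNReal.ofReal (rukhinLoss h (L θ (est x)) l - m) ∂(P θ)
        = ∫⁻ x, (ENNReal.ofReal (deriv h l) * ENNReal.ofReal (L θ (est x)) +
          ENNReal.ofReal (h l - deriv h l * l - m)) ∂(P θ) := by
          refine lintegral_congr fun x => ?_
          rw [← ENNReal.ofReal_mul hd, ← ENNReal.ofReal_add (mul_nonneg hd (hL0 _ _)) hi, rukhinLoss]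
          ring_nf
      _ = ENNReal.ofReal (deriv h l) * ∫⁻ x, ENNReal.ofReal (L θ (est x)) ∂(P θ) +
          ENNReal.ofReal (h l - deriv h l * l - m) := by
          rw [lintegral_add_right _ measurable_const, lintegral_const_mul' _ _ ENNReal.ofReal_ne_top,
            lintegral_const, measure_univ, mul_one]
      _ ≤ ENNReal.ofReal (deriv h l) * ENNReal.ofReal l +
          ENNReal.ofReal (h l - deriv h l * l - m) := by gcongr
      _ = ENNReal.ofReal (h l - m) := by
          rw [← ENNReal.ofReal_mul hd, ← ENNReal.ofReal_add (by positivity) hi]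
          ring_nf
  calc ((∫⁻ x, ENNReal.ofReal (rukhinLoss h (L θ (est x)) l - m) ∂(P θ) : ENNReal) : EReal)
        + (m : EReal) ≤ ((ENNReal.ofReal (h l - m) : ENNReal) : EReal) + (m : EReal) :=
        add_le_add_left (EReal.coe_ennreal_le_coe_ennreal_iff.2 key) _
    _ = h l := by
        rw [EReal.coe_ennreal_ofReal, max_eq_left (sub_nonneg.2 (hm l hl)), ← EReal.coe_add,
          sub_add_cancel]

theorem extExpectation_of_nonneg (μ : Measure 𝓧) {W : 𝓧 → ℝ} (hW : ∀ x, 0 ≤ W x) :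
    extExpectation μ W = ((∫⁻ x, ENNReal.ofReal (W x) ∂μ : ENNReal) : EReal) := by
  simp [extExpectation, fun x => ENNReal.ofReal_of_nonpos (neg_nonpos.2 (hW x))]

/-- An estimator with first-stage risk no larger than that of `est₀`, together with the constant
`l`, is minimax if `l` bounds the risk of `est₀` and is approached by lower bounds
`h (r * l)`, `r < 1`, for the supremum Rukhin risk. -/
theorem isRukhinMinimax_const {P : Θ → Measure 𝓧} [∀ θ, IsProbabilityMeasure (P θ)]
    {L : Θ → A → ℝ} {h : ℝ → ℝ} (h_diff : DifferentiableOn ℝ h (Set.Ioi 0))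
    (h_mono : MonotoneOn h (Set.Ioi 0)) (h_conc : ConcaveOn ℝ (Set.Ioi 0) h)
    (h_bdd : BddBelow (h '' Set.Ioi 0))
    (hL : Measurable (Function.uncurry L)) (hL0 : ∀ θ a, 0 ≤ L θ a) {est est₀ : 𝓧 → A}
    (he : Measurable est) {l : ℝ} (hl : 0 < l)
    (hdom : ∀ θ, firstStageRisk P L est θ ≤ firstStageRisk P L est₀ θ)
    (hrisk : ∀ θ, ∫⁻ x, ENNReal.ofReal (L θ (est₀ x)) ∂(P θ) ≤ ENNReal.ofReal l)
    (hlow : ∀ r, 0 < r → r < 1 → ∀ (est' : 𝓧 → A) (l' : 𝓧 → ℝ), IsPairEstimator est' l' →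
      (h (r * l) : EReal) ≤ ⨆ θ, rukhinRisk P L h est' l' θ) :
    IsRukhinMinimax P L h est fun _ => l := by
  refine ⟨⟨he, measurable_const, fun _ => hl⟩, fun est' l' hp => ?_⟩
  refine le_trans (b := (h l : EReal)) (iSup_le fun θ => ?_) ?_
  · refine rukhinRisk_const_le h_diff h_mono h_conc h_bdd hL hL0 he hl ?_
    have := hdom θ
    unfold firstStageRisk at this
    rw [extExpectation_of_nonneg _ fun x => hL0 _ _, extExpectation_of_nonneg _ fun x => hL0 _ _,
      EReal.coe_ennreal_le_coe_ennreal_iff] at this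
    exact this.trans (hrisk θ)
  · have hcont : ContinuousAt h (1 * l) := by
      rw [one_mul]
      exact (h_diff.differentiableAt (Ioi_mem_nhds hl)).continuousAt
    have h1 : Filter.Tendsto (fun r : ℝ => h (r * l)) (nhdsWithin 1 (Set.Iio 1)) (nhds (h l)) := by
      have h2 : ContinuousAt (fun r : ℝ => h (r * l)) 1 :=
        ContinuousAt.comp (f := fun r : ℝ => r * l) hcont (by fun_prop)
      have h3 := h2.tendsto
      simp only [one_mul] at h3
      exact h3.mono_left nhdsWithin_le_nhds
    have h2 : Filter.Tendsto (fun r : ℝ => (h (r * l) : EReal)) (nhdsWithin 1 (Set.Iio 1))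
        (nhds (h l : EReal)) := (continuous_coe_real_ereal.tendsto _).comp h1
    refine le_of_tendsto h2 ?_
    filter_upwards [Ioo_mem_nhdsLT (zero_lt_one (α := ℝ))] with r hr
    exact hlow r hr.1 hr.2 est' l' hp

end Minimax

/-! ### Gamma integrals on the positive half-line. -/

section GammaMoments

/-- Lebesgue measure on `(0, ∞)`. -/
noncomputable def posVolume : Measure {t : ℝ // 0 < t} := Measure.comap Subtype.val volume

instance sigmaFinite_posVolume : SigmaFinite posVolume :=
  SigmaFinite.of_map _ measurable_subtype_coe.aemeasurable <| by
    have h1 : posVolume.map Subtype.val = volume.restrict (Set.Ioi 0) :=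
      map_comap_subtype_coe (s := Set.Ioi (0 : ℝ)) measurableSet_Ioi volume
    rw [h1]
    infer_instance

theorem integral_pow_mul_exp_neg_mul_Ioi (k : ℕ) {c : ℝ} (hc : 0 < c) :
    ∫ t in Set.Ioi (0 : ℝ), t ^ k * Real.exp (-(c * t)) = k.factorial / c ^ (k + 1) := by
  have h1 := Real.integral_rpow_mul_exp_neg_mul_Ioi (a := (k : ℝ) + 1) (by positivity) hc
  simp only [add_sub_cancel_right, Real.rpow_natCast] at h1
  rw [h1, Real.Gamma_nat_eq_factorial, ← Nat.cast_add_one, Real.rpow_natCast, one_div,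
    inv_pow, div_eq_inv_mul]

theorem integrableOn_pow_mul_exp_neg_mul_Ioi (k : ℕ) {c : ℝ} (hc : 0 < c) :
    IntegrableOn (fun t : ℝ => t ^ k * Real.exp (-(c * t))) (Set.Ioi 0) := by
  -- A non-integrable function has Bochner integral 0 by convention, so a nonzero value proves
  -- integrability.
  refine Integrable.of_integral_ne_zero ?_
  rw [integral_pow_mul_exp_neg_mul_Ioi k hc]
  positivity

theorem lintegral_pos_ofReal {f : ℝ → ℝ} (hf : IntegrableOn f (Set.Ioi 0))
    (hf0 : ∀ t, 0 < t → 0 ≤ f t) :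
    ∫⁻ t, ENNReal.ofReal (f t) ∂posVolume = ENNReal.ofReal (∫ t in Set.Ioi 0, f t) := by
  rw [ofReal_integral_eq_lintegral_ofReal hf
    ((ae_restrict_iff' measurableSet_Ioi).2 (ae_of_all _ hf0))]
  exact lintegral_subtype_comap (s := Set.Ioi (0 : ℝ)) measurableSet_Ioi fun t => ENNReal.ofReal (f t)

/-- The density of the gamma distribution with shape `k + 1` and rate `c` on `(0, ∞)`. -/
noncomputable def posGammaPDF (c : ℝ) (k : ℕ) (t : {t : ℝ // 0 < t}) : ENNReal :=
  ENNReal.ofReal (c ^ (k + 1) / k.factorial * ((t : ℝ) ^ k * Real.exp (-(c * t))))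

/-- The gamma distribution with shape `k + 1` and rate `c` as a measure on `(0, ∞)`. -/
noncomputable def posGamma (c : ℝ) (k : ℕ) : Measure {t : ℝ // 0 < t} :=
  posVolume.withDensity (posGammaPDF c k)

theorem measurable_posGammaPDF (c : ℝ) (k : ℕ) : Measurable (posGammaPDF c k) := by
  unfold posGammaPDF
  fun_prop

theorem isProbabilityMeasure_posGamma {c : ℝ} (hc : 0 < c) (k : ℕ) :
    IsProbabilityMeasure (posGamma c k) := by
  constructor
  rw [posGamma, withDensity_apply _ MeasurableSet.univ, Measure.restrict_univ]
  unfold posGammaPDF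
  rw [lintegral_pos_ofReal (f := fun t => c ^ (k + 1) / k.factorial * (t ^ k * Real.exp (-(c * t))))
    ((integrableOn_pow_mul_exp_neg_mul_Ioi k hc).const_mul _) fun t ht => by positivity,
    integral_const_mul, integral_pow_mul_exp_neg_mul_Ioi k hc, ← ENNReal.ofReal_one]
  congr 1
  have := k.factorial_pos
  field_simp

/-- The shape is `k + 2`, so `E[1/t] = c/(k+1)` and `E[t] = (k+2)/c`. Completing the square in `a`
leaves `1/c` plus a square that vanishes at `a = (k+1)/c`; the minimum does not depend on `k`. -/
theorem le_lintegral_posGamma_weightedSq {c : ℝ} (hc : 0 < c) (k : ℕ) (a : ℝ) :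
    ENNReal.ofReal (1 / c) ≤
      ∫⁻ t, ENNReal.ofReal ((a - (t : ℝ)) ^ 2 / (t : ℝ)) ∂(posGamma c (k + 1)) := by
  rw [posGamma, lintegral_withDensity_eq_lintegral_mul _ (measurable_posGammaPDF c _) (by fun_prop)]
  set g : ℝ → ℝ := fun t => c ^ (k + 2) / (k + 1).factorial *
    (a ^ 2 * (t ^ k * Real.exp (-(c * t))) - 2 * a * (t ^ (k + 1) * Real.exp (-(c * t)))
      + t ^ (k + 2) * Real.exp (-(c * t))) with hg
  have hgt : ∀ t, g t = c ^ (k + 2) / (k + 1).factorial *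
      ((a - t) ^ 2 * (t ^ k * Real.exp (-(c * t)))) := fun t => by simp only [hg]; ring
  have h0 := (integrableOn_pow_mul_exp_neg_mul_Ioi k hc).const_mul (a ^ 2)
  have h1 := (integrableOn_pow_mul_exp_neg_mul_Ioi (k + 1) hc).const_mul (2 * a)
  have h2 := integrableOn_pow_mul_exp_neg_mul_Ioi (k + 2) hc
  have hcongr : ∀ t : {t : ℝ // 0 < t}, (posGammaPDF c (k + 1) * fun t : {t : ℝ // 0 < t} =>
      ENNReal.ofReal ((a - (t : ℝ)) ^ 2 / (t : ℝ))) t = ENNReal.ofReal (g t) := by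
    rintro ⟨t, ht⟩
    rw [Pi.mul_apply, posGammaPDF, ← ENNReal.ofReal_mul (by positivity), hgt]
    congr 1
    simp only
    field_simp
    ring
  rw [lintegral_congr hcongr, lintegral_pos_ofReal (f := g) (((h0.sub h1).add h2).const_mul _) fun t ht => by
    rw [hgt]; positivity]
  refine ENNReal.ofReal_le_ofReal ?_
  have hI : ∫ t in Set.Ioi 0, g t = c ^ (k + 2) / (k + 1).factorial *
      (a ^ 2 * (k.factorial / c ^ (k + 1)) - 2 * a * ((k + 1).factorial / c ^ (k + 2))
        + (k + 2).factorial / c ^ (k + 3)) := by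
    rw [integral_const_mul, integral_add (by exact h0.sub h1) h2, integral_sub h0 h1, integral_const_mul,
      integral_const_mul, integral_pow_mul_exp_neg_mul_Ioi _ hc,
      integral_pow_mul_exp_neg_mul_Ioi _ hc, integral_pow_mul_exp_neg_mul_Ioi _ hc]
  have hk : (k.factorial : ℝ) ≠ 0 := by positivity
  have hk1 : (0 : ℝ) < k + 1 := by positivity
  have hS : ∫ t in Set.Ioi 0, g t = 1 / c + (c * a - (k + 1)) ^ 2 / (c * (k + 1)) := by
    rw [hI, Nat.factorial_succ (k + 1), Nat.factorial_succ k]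
    push_cast
    field_simp
    ring
  rw [hS]
  have : 0 ≤ (c * a - (k + 1)) ^ 2 / (c * (k + 1)) := by positivity
  linarith

end GammaMoments

/-! ### The Poisson model with gamma priors. -/

section Poisson

theorem poissonModel_singleton (d : ℕ) (θ : Fin d → {t : ℝ // 0 < t}) (x : Fin d → ℕ) :
    poissonModel d θ {x} =
      ∏ i, ENNReal.ofReal (Real.exp (-(θ i : ℝ)) * (θ i : ℝ) ^ x i / (x i).factorial) := by
  rw [poissonModel, Measure.pi_singleton]
  refine Finset.prod_congr rfl fun i _ => ?_
  rw [poissonMeasure_singleton, Real.coe_toNNReal _ (θ i).2.le]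

/-- The gamma–Poisson (negative binomial) probability of `k`, for a gamma prior with shape `2` and
rate `b`. -/
noncomputable def gammaPoissonMass (b : ℝ) (k : ℕ) : ENNReal :=
  ENNReal.ofReal (b ^ 2 * (k + 1) / (1 + b) ^ (k + 2))

/-- Conjugacy: prior times likelihood equals marginal times posterior. Prior shape 2 gives posterior
shape `k + 2`, so `1/t` has finite posterior mean even at `k = 0`. -/
theorem posGammaPDF_mul_poisson {b : ℝ} (hb : 0 < b) (k : ℕ) (t : {t : ℝ // 0 < t}) :
    posGammaPDF b 1 t * ENNReal.ofReal (Real.exp (-(t : ℝ)) * (t : ℝ) ^ k / k.factorial) =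
      gammaPoissonMass b k * posGammaPDF (1 + b) (k + 1) t := by
  obtain ⟨t, ht⟩ := t
  rw [gammaPoissonMass, posGammaPDF, posGammaPDF, ← ENNReal.ofReal_mul (by positivity),
    ← ENNReal.ofReal_mul (by positivity)]
  congr 1
  simp only
  rw [show -((1 + b) * t) = -t + -(b * t) by ring, Real.exp_add, Nat.factorial_succ k]
  push_cast
  field_simp
  simp [pow_succ']

theorem pi_posGamma_eq_withDensity {d : ℕ} {c : Fin d → ℝ} (hc : ∀ i, 0 < c i) (k : Fin d → ℕ) :
    Measure.pi (fun i => posGamma (c i) (k i)) =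
      (Measure.pi fun _ : Fin d => posVolume).withDensity
        fun θ => ∏ i, posGammaPDF (c i) (k i) (θ i) := by
  refine pi_withDensity (μ := fun _ : Fin d => posVolume)
    (f := fun i => posGammaPDF (c i) (k i)) (fun i => measurable_posGammaPDF _ _) fun i => ?_
  have := isProbabilityMeasure_posGamma (hc i) (k i)
  rw [posGamma] at this
  infer_instance

/-- Bayes' formula for independent Poisson observations with independent gamma priors. -/
theorem lintegral_poisson_bayes (d : ℕ) {b : ℝ} (hb : 0 < b)
    {F : (Fin d → {t : ℝ // 0 < t}) → (Fin d → ℕ) → ENNReal}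
    (hF : Measurable (Function.uncurry F)) :
    ∫⁻ θ, ∫⁻ x, F θ x ∂(poissonModel d θ) ∂(Measure.pi fun _ => posGamma b 1) =
      ∫⁻ x, ∫⁻ θ, F θ x ∂(Measure.pi fun i => posGamma (1 + b) (x i + 1))
        ∂(Measure.count.withDensity fun x : Fin d → ℕ => ∏ i, gammaPoissonMass b (x i)) := by
  have hFx : ∀ x, Measurable fun θ => F θ x := fun x => hF.comp measurable_prodMk_right
  have hpois : ∀ x : Fin d → ℕ, Measurable fun θ : Fin d → {t : ℝ // 0 < t} =>
      ∏ i, ENNReal.ofReal (Real.exp (-(θ i : ℝ)) * (θ i : ℝ) ^ x i / (x i).factorial) := by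
    intro x
    refine Finset.measurable_fun_prod _ fun i _ => ?_
    fun_prop
  have hgam : ∀ (c : ℝ) (k : Fin d → ℕ), Measurable fun θ : Fin d → {t : ℝ // 0 < t} =>
      ∏ i, posGammaPDF c (k i) (θ i) := fun c k =>
    Finset.measurable_fun_prod _ fun i _ => (measurable_posGammaPDF c (k i)).comp (measurable_pi_apply i)
  have hb1 : (0 : ℝ) < 1 + b := by linarith
  -- The sample space is countable: integrals over `x` become series, and after Tonelli the two
  -- sides agree term by term.
  simp_rw [lintegral_countable', poissonModel_singleton]
  rw [lintegral_tsum fun x => ((hFx x).fun_mul (hpois x)).aemeasurable]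
  refine tsum_congr fun x => ?_
  rw [withDensity_apply _ (measurableSet_singleton x), Measure.restrict_singleton,
    lintegral_smul_measure, lintegral_dirac, Measure.count_singleton, one_smul,
    pi_posGamma_eq_withDensity (fun _ => hb) fun _ => 1,
    pi_posGamma_eq_withDensity (fun _ => hb1) fun i => x i + 1,
    lintegral_withDensity_eq_lintegral_mul _ (hgam _ _) ((hFx x).fun_mul (hpois x)),
    lintegral_withDensity_eq_lintegral_mul _ (hgam _ _) (hFx x), mul_comm _ (∏ i, _),
    ← lintegral_const_mul _ ((hgam _ _).mul (hFx x))]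
  refine lintegral_congr fun θ => ?_
  simp only [Pi.mul_apply]
  rw [mul_left_comm, ← Finset.prod_mul_distrib, mul_comm (F θ x), ← mul_assoc,
    ← Finset.prod_mul_distrib]
  simp_rw [posGammaPDF_mul_poisson hb]

theorem le_lintegral_poissonLoss (d : ℕ) {c : ℝ} (hc : 0 < c) (x : Fin d → ℕ) (a : Fin d → ℝ) :
    ENNReal.ofReal (d / c) ≤ ∫⁻ θ, ENNReal.ofReal (poissonLoss d θ a)
      ∂(Measure.pi fun i => posGamma c (x i + 1)) := by
  have := fun i => isProbabilityMeasure_posGamma hc (x i + 1)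
  unfold poissonLoss
  have hsplit : ∀ θ : Fin d → {t : ℝ // 0 < t}, ENNReal.ofReal
      (∑ i, (a i - (θ i : ℝ)) ^ 2 / (θ i : ℝ)) =
        ∑ i, ENNReal.ofReal ((a i - (θ i : ℝ)) ^ 2 / (θ i : ℝ)) := fun θ =>
    ENNReal.ofReal_sum_of_nonneg fun i _ => div_nonneg (sq_nonneg _) (θ i).2.le
  simp_rw [hsplit]
  rw [lintegral_finsetSum _ fun i _ => by fun_prop]
  calc ENNReal.ofReal (d / c) = ∑ _i : Fin d, ENNReal.ofReal (1 / c) := by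
        rw [← ENNReal.ofReal_sum_of_nonneg fun i _ => by positivity]
        simp [div_eq_mul_inv]
    _ ≤ _ := by
        refine Finset.sum_le_sum fun i _ => ?_
        rw [(measurePreserving_eval (fun i => posGamma c (x i + 1)) i).lintegral_comp
          (f := fun t : {t : ℝ // 0 < t} => ENNReal.ofReal ((a i - (t : ℝ)) ^ 2 / (t : ℝ)))
          (by fun_prop)]
        exact le_lintegral_posGamma_weightedSq hc (x i) (a i)

theorem hasSum_poisson_sq_sub (r : NNReal) :
    HasSum (fun n : ℕ => Real.exp (-r) * (r : ℝ) ^ n / n.factorial * ((n : ℝ) - r) ^ 2) r := by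
  have h0 := hasSum_one_poissonMeasure r
  -- The `n = 0` term vanishes, and the Poisson masses satisfy `(n + 1) p (n + 1) = r p n`; the
  -- second moment uses the same shift.
  have h1 : HasSum (fun n : ℕ => Real.exp (-r) * (r : ℝ) ^ n / n.factorial * n) r := by
    rw [← hasSum_nat_add_iff' 1]
    simp only [Finset.range_one, Finset.sum_singleton, Nat.cast_zero, mul_zero, sub_zero]
    convert! h0.mul_left (r : ℝ) using 1
    · ext n
      rw [Nat.factorial_succ]
      push_cast
      field_simp
      ring
    · simp
  have h2 : HasSum (fun n : ℕ => Real.exp (-r) * (r : ℝ) ^ n / n.factorial * (n : ℝ) ^ 2)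
      (r * (r + 1)) := by
    rw [← hasSum_nat_add_iff' 1]
    simp only [Finset.range_one, Finset.sum_singleton, Nat.cast_zero, ne_eq, OfNat.ofNat_ne_zero,
      not_false_eq_true, zero_pow, mul_zero, sub_zero]
    convert! (h1.add h0).mul_left (r : ℝ) using 1
    ext n
    rw [Nat.factorial_succ]
    push_cast
    field_simp
    ring
  convert! (h2.sub (h1.mul_left (2 * (r : ℝ)))).add (h0.mul_left ((r : ℝ) ^ 2)) using 1
  · ext n
    ring
  · ring

theorem lintegral_poissonLoss_self (d : ℕ) (θ : Fin d → {t : ℝ // 0 < t}) :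
    ∫⁻ x, ENNReal.ofReal (poissonLoss d θ fun i => (x i : ℝ)) ∂(poissonModel d θ) = d := by
  unfold poissonLoss poissonModel
  simp_rw [ENNReal.ofReal_sum_of_nonneg fun i _ => div_nonneg (sq_nonneg _) (Subtype.prop (θ i)).le]
  rw [lintegral_finsetSum _ fun i _ => by fun_prop]
  have h1 : ∀ i, ∫⁻ x : Fin d → ℕ, ENNReal.ofReal (((x i : ℝ) - (θ i : ℝ)) ^ 2 / (θ i : ℝ))
      ∂(Measure.pi fun i => poissonMeasure (Real.toNNReal (θ i : ℝ))) = 1 := fun i => by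
    rw [(measurePreserving_eval (fun i => poissonMeasure (Real.toNNReal (θ i : ℝ))) i).lintegral_comp
      (f := fun n : ℕ => ENNReal.ofReal (((n : ℝ) - (θ i : ℝ)) ^ 2 / (θ i : ℝ))) (by fun_prop),
      lintegral_countable']
    have hθ := (θ i).2
    have hs := (hasSum_poisson_sq_sub (Real.toNNReal (θ i : ℝ))).mul_left ((θ i : ℝ)⁻¹)
    rw [Real.coe_toNNReal _ hθ.le, inv_mul_cancel₀ hθ.ne'] at hs
    simp_rw [poissonMeasure_singleton, Real.coe_toNNReal _ hθ.le]
    rw [← ENNReal.ofReal_one, ← hs.tsum_eq, ENNReal.ofReal_tsum_of_nonneg _ hs.summable]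
    · refine tsum_congr fun n => ?_
      rw [← ENNReal.ofReal_mul (by positivity)]
      ring_nf
    · intro n
      positivity
  simp [h1]

theorem isRukhinMinimax_poisson {h : ℝ → ℝ} (h_diff : DifferentiableOn ℝ h (Set.Ioi 0))
    (h_mono : MonotoneOn h (Set.Ioi 0)) (h_conc : ConcaveOn ℝ (Set.Ioi 0) h)
    (h_bdd : BddBelow (h '' Set.Ioi 0)) {d : ℕ} (hd : 0 < d)
    {est : (Fin d → ℕ) → (Fin d → ℝ)} (he : Measurable est)
    (hdom : Dominates (poissonModel d) (poissonLoss d) est (fun x i => (x i : ℝ))) :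
    IsRukhinMinimax (poissonModel d) (poissonLoss d) h est (fun _ => (d : ℝ)) := by
  have hP : ∀ θ, IsProbabilityMeasure (poissonModel d θ) := fun θ => by
    unfold poissonModel; infer_instance
  have hL0 : ∀ θ a, 0 ≤ poissonLoss d θ a := fun θ a =>
    Finset.sum_nonneg fun i _ => div_nonneg (sq_nonneg _) (θ i).2.le
  have hL : Measurable (Function.uncurry (poissonLoss d)) := by
    unfold poissonLoss Function.uncurry
    refine Finset.measurable_fun_sum _ fun i _ => ?_
    fun_prop
  have hd' : (0 : ℝ) < d := Nat.cast_pos.2 hd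
  refine isRukhinMinimax_const h_diff h_mono h_conc h_bdd hL hL0 he hd' hdom.1
    (fun θ => by rw [lintegral_poissonLoss_self]; simp) fun r hr0 hr1 est' l' hp => ?_
  -- The prior rate `1 / r - 1` gives posterior rate `1 / r`, hence posterior risk at least `r * d`.
  have hb : 0 < 1 / r - 1 := sub_pos.2 ((one_lt_div hr0).2 hr1)
  have hc : 0 < 1 + (1 / r - 1) := by linarith
  have := fun _ : Fin d => isProbabilityMeasure_posGamma hb 1
  have := fun (x : Fin d → ℕ) (i : Fin d) => isProbabilityMeasure_posGamma hc (x i + 1)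
  refine le_iSup_rukhinRisk_of_bayes h_diff h_mono h_conc h_bdd hL hL0
    (Measure.pi fun _ => posGamma (1 / r - 1) 1)
    (Measure.count.withDensity fun x : Fin d → ℕ => ∏ i, gammaPoissonMass (1 / r - 1) (x i))
    (fun x => Measure.pi fun i => posGamma (1 + (1 / r - 1)) (x i + 1))
    (fun F hF => lintegral_poisson_bayes d hb hF) (by positivity) (fun x a => ?_) hp
  have h1 := le_lintegral_poissonLoss d hc x a
  rwa [show (d : ℝ) / (1 + (1 / r - 1)) = r * d by rw [add_sub_cancel]; field_simp] at h1

end Poisson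

/-! ### The normal model with normal priors. -/

section Normal

/-- Here `r * t` is a convex combination of `t` and 0, and `β 0 ≥ 0`. This controls both the
shrunken posterior loss and the growth of `β`. -/
theorem ConcaveOn.mul_le_map_mul_of_nonneg {β : ℝ → ℝ} (hβ : ConcaveOn ℝ (Set.Ici 0) β)
    (h0 : 0 ≤ β 0) {r : ℝ} (hr0 : 0 ≤ r) (hr1 : r ≤ 1) {t : ℝ} (ht : 0 ≤ t) :
    r * β t ≤ β (r * t) := by
  have h1 := hβ.2 (Set.mem_Ici.2 ht) (Set.mem_Ici.2 le_rfl) hr0 (sub_nonneg.2 hr1)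
    (add_sub_cancel r 1)
  simp only [smul_eq_mul, mul_zero, add_zero] at h1
  nlinarith [mul_nonneg (sub_nonneg.2 hr1) h0]

theorem continuous_comp_max_zero {β : ℝ → ℝ} (hβ : ContinuousOn β (Set.Ici 0)) :
    Continuous fun t => β (max t 0) :=
  hβ.comp_continuous (by fun_prop) fun t => le_max_right t 0

theorem ContinuousOn.continuous_comp_norm_sq {E : Type*} [SeminormedAddCommGroup E] {β : ℝ → ℝ}
    (hβ : ContinuousOn β (Set.Ici 0)) : Continuous fun y : E => β (‖y‖ ^ 2) :=
  hβ.comp_continuous (by fun_prop) fun y => sq_nonneg ‖y‖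

theorem measurable_uncurry_scaledSqLoss {d : ℕ} {σ : ℝ} {β : ℝ → ℝ}
    (hβ : ContinuousOn β (Set.Ici 0)) :
    Measurable (Function.uncurry fun θ a : EuclideanSpace ℝ (Fin d) => β (scaledSqLoss d σ θ a)) := by
  have h1 : Continuous fun p : EuclideanSpace ℝ (Fin d) × EuclideanSpace ℝ (Fin d) =>
      β (‖p.2 - p.1‖ ^ 2 / σ ^ 2) :=
    hβ.comp_continuous (by fun_prop) fun p => Set.mem_Ici.2 (by positivity)
  exact h1.measurable

/-- The posterior covariance is `r σ² I`, so by Anderson every action has posterior risk at least `E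
β(r ‖Y‖²)`, with `Y` standard normal, and concavity bounds this below by `r E β(‖Y‖²) = r * l`. -/
theorem isRukhinMinimax_normal {h : ℝ → ℝ} (h_diff : DifferentiableOn ℝ h (Set.Ioi 0))
    (h_mono : MonotoneOn h (Set.Ioi 0)) (h_conc : ConcaveOn ℝ (Set.Ioi 0) h)
    (h_bdd : BddBelow (h '' Set.Ioi 0)) {d : ℕ} {σ : ℝ} (hσ : 0 < σ) {β : ℝ → ℝ}
    (hβc : ContinuousOn β (Set.Ici 0)) (hβm : MonotoneOn β (Set.Ici 0))
    (hβ : ConcaveOn ℝ (Set.Ici 0) β) (hβ0 : 0 ≤ β 0) {l : ℝ} (hl : 0 < l)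
    (hlβ : ENNReal.ofReal l =
      ∫⁻ y, ENNReal.ofReal (β (‖y‖ ^ 2)) ∂(stdGaussian (EuclideanSpace ℝ (Fin d))))
    {est : EuclideanSpace ℝ (Fin d) → EuclideanSpace ℝ (Fin d)} (he : Measurable est)
    (hdom : Dominates (normalModel d σ) (fun θ a => β (scaledSqLoss d σ θ a)) est fun x => x) :
    IsRukhinMinimax (normalModel d σ) (fun θ a => β (scaledSqLoss d σ θ a)) h est fun _ => l := by
  have hP : ∀ θ, IsProbabilityMeasure (normalModel d σ θ) := fun θ => by
    unfold normalModel; infer_instance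
  have hpos : ∀ t, 0 ≤ t → 0 ≤ β t := fun t ht =>
    hβ0.trans (hβm (Set.mem_Ici.2 le_rfl) (Set.mem_Ici.2 ht) ht)
  have hL0 : ∀ θ a, 0 ≤ β (scaledSqLoss d σ θ a) := fun θ a =>
    hpos _ (div_nonneg (sq_nonneg _) (sq_nonneg _))
  have hL := measurable_uncurry_scaledSqLoss (d := d) (σ := σ) hβc
  refine isRukhinMinimax_const h_diff h_mono h_conc h_bdd hL hL0 he hl hdom.1 (fun θ => ?_)
    fun r hr0 hr1 est' l' hp => ?_
  · have hm : Measurable fun x => ENNReal.ofReal (β (scaledSqLoss d σ θ x)) :=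
      (hL.comp measurable_prodMk_left).ennreal_ofReal
    rw [normalModel_eq_map d hσ, lintegral_map hm (by fun_prop), hlβ]
    refine le_of_eq (lintegral_congr fun y => ?_)
    rw [scaledSqLoss, add_sub_cancel_left, norm_smul, mul_pow, Real.norm_eq_abs, sq_abs,
      mul_div_cancel_left₀ _ (by positivity)]
  -- With prior variance `τ² = σ² tan² φ`, the shrinkage factor `τ² / (τ² + σ²)` is `sin² φ`, which
  -- is set equal to `r`.
  obtain ⟨φ, hs, hc, hsr⟩ : ∃ φ : ℝ, 0 < Real.sin φ ∧ 0 < Real.cos φ ∧ Real.sin φ ^ 2 = r := by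
    have hq : √r < 1 := by rw [Real.sqrt_lt' one_pos]; simpa
    refine ⟨Real.arcsin √r, ?_, ?_, ?_⟩
    · rw [Real.sin_arcsin (by linarith [Real.sqrt_nonneg r]) hq.le]
      exact Real.sqrt_pos.2 hr0
    · rw [Real.cos_arcsin, Real.sq_sqrt hr0.le]
      exact Real.sqrt_pos.2 (by linarith)
    · rw [Real.sin_arcsin (by linarith [Real.sqrt_nonneg r]) hq.le, Real.sq_sqrt hr0.le]
  set γ := stdGaussian (EuclideanSpace ℝ (Fin d)) with hγ
  have hprior : IsProbabilityMeasure (γ.map fun u => (σ * Real.tan φ) • u) :=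
    Measure.isProbabilityMeasure_map (by fun_prop)
  have hpostprob : ∀ x : EuclideanSpace ℝ (Fin d), IsProbabilityMeasure
      (γ.map fun z => (Real.sin φ ^ 2) • x + (σ * Real.sin φ) • z) := fun x =>
    Measure.isProbabilityMeasure_map (by fun_prop)
  refine le_iSup_rukhinRisk_of_bayes h_diff h_mono h_conc h_bdd hL hL0
    (γ.map fun u => (σ * Real.tan φ) • u) (γ.map fun x => (σ / Real.cos φ) • x)
    (fun x => γ.map fun z => (Real.sin φ ^ 2) • x + (σ * Real.sin φ) • z)
    (fun F hF => ?_) (by positivity) (fun x a => ?_) hp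
  · have hFc : ∀ {T : Type} [MeasurableSpace T] {f g : T → EuclideanSpace ℝ (Fin d)},
        Measurable f → Measurable g → Measurable fun t => F (f t) (g t) := fun hf hg =>
      hF.comp (hf.prodMk hg)
    have h1 : ∀ θ, ∫⁻ x, F θ x ∂(normalModel d σ θ) = ∫⁻ y, F θ (θ + σ • y) ∂γ := fun θ => by
      rw [normalModel_eq_map d hσ, lintegral_map (hFc (f := fun _ => θ) (g := fun x => x) (by fun_prop) (by fun_prop)) (by fun_prop)]
    have h2 : ∀ x, ∫⁻ θ, F θ x ∂(γ.map fun z => (Real.sin φ ^ 2) • x + (σ * Real.sin φ) • z) =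
        ∫⁻ z, F ((Real.sin φ ^ 2) • x + (σ * Real.sin φ) • z) x ∂γ := fun x => by
      rw [lintegral_map (hFc (f := fun θ => θ) (g := fun _ => x) (by fun_prop) (by fun_prop)) (by fun_prop)]
    simp_rw [h1, h2]
    rw [lintegral_map _ (by fun_prop), lintegral_map _ (by fun_prop)]
    · exact lintegral_normal_bayes d σ φ hc.ne' hF
    · refine Measurable.lintegral_prod_right' (f := fun p : EuclideanSpace ℝ (Fin d) ×
        EuclideanSpace ℝ (Fin d) => F ((Real.sin φ ^ 2) • p.1 + (σ * Real.sin φ) • p.2) p.1) ?_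
      exact hFc (by fun_prop) (by fun_prop)
    · refine Measurable.lintegral_prod_right' (f := fun p : EuclideanSpace ℝ (Fin d) ×
        EuclideanSpace ℝ (Fin d) => F p.1 (p.1 + σ • p.2)) ?_
      exact hFc (by fun_prop) (by fun_prop)
  -- The truncation `max u 0` makes `f` monotone on all of `ℝ`, though `β` is controlled only on
  -- `[0, ∞)`.
  · set f : ℝ → ENNReal := fun u => ENNReal.ofReal (β (r * max u 0 ^ 2)) with hf
    have hfmono : Monotone f := fun u v huv => by
      refine ENNReal.ofReal_le_ofReal (hβm (Set.mem_Ici.2 (by positivity))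
        (Set.mem_Ici.2 (by positivity)) ?_)
      gcongr
    have hLx : Measurable fun θ => ENNReal.ofReal (β (scaledSqLoss d σ θ a)) :=
      (hL.comp measurable_prodMk_right).ennreal_ofReal
    rw [lintegral_map hLx (by fun_prop)]
    calc ENNReal.ofReal (r * l)
        = ∫⁻ y, ENNReal.ofReal r * ENNReal.ofReal (β (‖y‖ ^ 2)) ∂γ := by
          rw [ENNReal.ofReal_mul hr0.le, hlβ, lintegral_const_mul' _ _ ENNReal.ofReal_ne_top]
      _ ≤ ∫⁻ y, f ‖y‖ ∂γ := lintegral_mono fun y => by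
          rw [hf, ← ENNReal.ofReal_mul hr0.le]
          simp only [max_eq_left (norm_nonneg y)]
          exact ENNReal.ofReal_le_ofReal
            (hβ.mul_le_map_mul_of_nonneg hβ0 hr0.le hr1.le (sq_nonneg _))
      _ ≤ ∫⁻ y, f ‖y - (σ * Real.sin φ)⁻¹ • (a - (Real.sin φ ^ 2) • x)‖ ∂γ :=
          lintegral_norm_le_lintegral_norm_sub_stdGaussian d hfmono _
      _ = _ := lintegral_congr fun y => by
          simp only [hf, max_eq_left (norm_nonneg _), scaledSqLoss]
          congr 2
          have hne : σ * Real.sin φ ≠ 0 := by positivity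
          have h1 : a - ((Real.sin φ ^ 2) • x + (σ * Real.sin φ) • y) = (-(σ * Real.sin φ)) •
              (y - (σ * Real.sin φ)⁻¹ • (a - (Real.sin φ ^ 2) • x)) := by
            rw [smul_sub, smul_smul, neg_mul, mul_inv_cancel₀ hne, neg_smul, neg_one_smul]
            abel
          rw [h1, norm_smul, mul_pow, Real.norm_eq_abs, sq_abs, neg_sq, mul_pow, hsr]
          field_simp

/-- Concavity and monotonicity give `β t ≤ (t + 1) β 1` for `t ≥ 0`, so `β(‖Y‖²)` is integrable
because `‖Y‖²` is. -/
theorem ofReal_integral_chiSquare {d : ℕ} {β : ℝ → ℝ} (hβc : ContinuousOn β (Set.Ici 0))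
    (hβm : MonotoneOn β (Set.Ici 0)) (hβ : ConcaveOn ℝ (Set.Ici 0) β) (hβ0 : 0 ≤ β 0) :
    ENNReal.ofReal (∫ z, β z ∂(chiSquare d)) =
      ∫⁻ y, ENNReal.ofReal (β (‖y‖ ^ 2)) ∂(stdGaussian (EuclideanSpace ℝ (Fin d))) := by
  have hpos : ∀ t, 0 ≤ t → 0 ≤ β t := fun t ht =>
    hβ0.trans (hβm (Set.mem_Ici.2 le_rfl) (Set.mem_Ici.2 ht) ht)
  have h1 : ∫ z, β z ∂(chiSquare d) =
      ∫ y, β (‖y‖ ^ 2) ∂(stdGaussian (EuclideanSpace ℝ (Fin d))) := by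
    have hnn : ∀ᵐ t ∂(chiSquare d), 0 ≤ t := by
      rw [chiSquare, ae_map_iff (by fun_prop) measurableSet_Ici]
      exact ae_of_all _ fun y => sq_nonneg _
    have hae : β =ᵐ[chiSquare d] fun t => β (max t 0) := by
      filter_upwards [hnn] with t ht
      rw [max_eq_left ht]
    rw [integral_congr_ae hae, chiSquare, integral_map (by fun_prop)
      (continuous_comp_max_zero hβc).aestronglyMeasurable]
    exact integral_congr_ae (ae_of_all _ fun y => by simp only [max_eq_left (sq_nonneg ‖y‖)])
  rw [h1, ofReal_integral_eq_lintegral_ofReal _ (ae_of_all _ fun y => hpos _ (sq_nonneg _))]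
  have hsq : Integrable (fun y => ‖y‖ ^ 2) (stdGaussian (EuclideanSpace ℝ (Fin d))) :=
    IsGaussian.memLp_two_id.integrable_norm_pow two_ne_zero
  refine ((hsq.add (integrable_const 1)).mul_const (β 1)).mono'
    hβc.continuous_comp_norm_sq.aestronglyMeasurable (ae_of_all _ fun y => ?_)
  rw [Real.norm_of_nonneg (hpos _ (sq_nonneg _))]
  simp only [Pi.add_apply]
  have h1 := hpos 1 zero_le_one
  rcases le_total (‖y‖ ^ 2) 1 with hy | hy
  · have := hβm (Set.mem_Ici.2 (sq_nonneg ‖y‖)) (Set.mem_Ici.2 zero_le_one) hy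
    nlinarith [mul_nonneg (sq_nonneg ‖y‖) h1]
  · have hy0 : 0 < ‖y‖ ^ 2 := by linarith
    have := hβ.mul_le_map_mul_of_nonneg hβ0 (inv_nonneg.2 hy0.le) (inv_le_one_of_one_le₀ hy) hy0.le
    rw [inv_mul_cancel₀ hy0.ne', inv_mul_le_iff₀ hy0] at this
    linarith

/-- A zero mean would force `β(‖Y‖²) = 0` almost surely, hence `Y = 0` almost surely by strict
monotonicity, against `E‖Y‖² = d > 0`. -/
theorem integral_chiSquare_pos {d : ℕ} (hd : 0 < d) {β : ℝ → ℝ} (hβc : ContinuousOn β (Set.Ici 0))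
    (hβm : StrictMonoOn β (Set.Ici 0)) (hβ : ConcaveOn ℝ (Set.Ici 0) β) (hβ0 : 0 ≤ β 0) :
    0 < ∫ z, β z ∂(chiSquare d) := by
  rw [← ENNReal.ofReal_pos, ofReal_integral_chiSquare hβc hβm.monotoneOn hβ hβ0, pos_iff_ne_zero]
  intro h0
  rw [lintegral_eq_zero_iff hβc.continuous_comp_norm_sq.measurable.ennreal_ofReal] at h0
  have h1 : ∫⁻ y, ENNReal.ofReal (‖y‖ ^ 2) ∂(stdGaussian (EuclideanSpace ℝ (Fin d))) = 0 := by
    rw [lintegral_eq_zero_iff (by fun_prop)]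
    filter_upwards [h0] with y hy
    simp only [Pi.zero_apply, ENNReal.ofReal_eq_zero] at hy ⊢
    by_contra hlt
    rw [not_le] at hlt
    have := hβm (Set.mem_Ici.2 le_rfl) (Set.mem_Ici.2 hlt.le) hlt
    linarith
  rw [lintegral_norm_sq_stdGaussian] at h1
  exact hd.ne' (by exact_mod_cast h1)

end Normal

theorem mainTheorem5 (h : ℝ → ℝ)
    (h_diff : DifferentiableOn ℝ h (Set.Ioi 0)) (h_mono : MonotoneOn h (Set.Ioi 0))
    (h_conc : ConcaveOn ℝ (Set.Ioi 0) h) (h_bdd : BddBelow (h '' Set.Ioi 0)) :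
    (∀ (d : ℕ) (σ : ℝ), 3 ≤ d → 0 < σ →
      ∀ est : EuclideanSpace ℝ (Fin d) → EuclideanSpace ℝ (Fin d), Measurable est →
        Dominates (normalModel d σ) (scaledSqLoss d σ) est (fun x => x) →
        IsRukhinMinimax (normalModel d σ) (scaledSqLoss d σ) h est (fun _ => (d : ℝ))) ∧
    (∀ (d : ℕ) (σ : ℝ) (β : ℝ → ℝ), 4 ≤ d → 0 < σ →
      ContinuousOn β (Set.Ici 0) → StrictMonoOn β (Set.Ici 0) → ConcaveOn ℝ (Set.Ici 0) β →
      0 ≤ β 0 →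
      ∀ est : EuclideanSpace ℝ (Fin d) → EuclideanSpace ℝ (Fin d), Measurable est →
        Dominates (normalModel d σ) (fun θ a => β (scaledSqLoss d σ θ a)) est (fun x => x) →
        IsRukhinMinimax (normalModel d σ) (fun θ a => β (scaledSqLoss d σ θ a)) h est
          (fun _ => ∫ z, β z ∂(chiSquare d))) ∧
    (∀ d : ℕ, 2 ≤ d →
      ∀ est : (Fin d → ℕ) → (Fin d → ℝ), Measurable est →
        Dominates (poissonModel d) (poissonLoss d) est (fun x i => (x i : ℝ)) →
        IsRukhinMinimax (poissonModel d) (poissonLoss d) h est (fun _ => (d : ℝ))) := by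
  refine ⟨fun d σ hd hσ est he hdom => ?_, fun d σ β hd hσ hβc hβm hβ hβ0 est he hdom => ?_,
    fun d hd est he hdom => isRukhinMinimax_poisson h_diff h_mono h_conc h_bdd (by omega) he hdom⟩
  · refine isRukhinMinimax_normal h_diff h_mono h_conc h_bdd hσ (β := fun t => t) continuousOn_id
      monotoneOn_id (concaveOn_id (convex_Ici 0)) le_rfl (Nat.cast_pos.2 (by omega)) ?_ he hdom
    rw [lintegral_norm_sq_stdGaussian, ENNReal.ofReal_natCast]
  · exact isRukhinMinimax_normal h_diff h_mono h_conc h_bdd hσ hβc hβm.monotoneOn hβ hβ0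
      (integral_chiSquare_pos (by omega) hβc hβm hβ hβ0)
      (ofReal_integral_chiSquare hβc hβm.monotoneOn hβ hβ0) he hdom
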